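/- **Setting.** Let $n=m^2$ and let $G$ be the $(m\times m)$-oriented grid (every edge knows its cardinal direction). A deterministic online-LOCAL algorithm with locality $T$ labels nodes in the adversarial order $v_1,v_2,\dots$ in which they are revealed: the label of $v_i$ is a function of the isomorphism type of the oriented subgraph of $G$ induced by $\bigcup_{j\le i}B(v_j,T)$, together with the sequence $v_1,\dots,v_i$ and the labels of $v_1,\dots,v_{i-1}$. Here labels are colors in $\{1,2,3\}$, and the algorithm is supposed to produce a proper $3$-coloring $c$ of $G$. For an edge $\{u,v\}$ put $p(u,v)=c(u)-c(v)$ if $c(u)\ne 3\ne c(v)$ and $p(u,v)=0$ otherwise; for a walk $W$ let $p(W)$ be the sum of $p$ over its consecutive edges and $|W|$ its number of edges. **Lemma (quasilinear boosting on a row).** There is an absolute constant $K$ such that the following holds. Let $T=T(n)\ge 1$ be integer valued with $T=o(\log n)$. Then for all sufficiently large $n=m^2$, every deterministic online-LOCAL algorithm with locality $T$ on $G$, and every $N$ with $N\le \sqrt n-2\cdot 2^{10T}$, an adversary can reveal at most $(N+1)+2^{10T}$ distinct nodes of $G$ such that either * the algorithm fails: two adjacent revealed nodes receive the same color; or * the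 revealed nodes contain a row $R$ of length $N$ (that is, $N+1$ consecutive nodes from west to east) such that every subpath $W'$ of $R$ with $|W'|\ge 2^{10T}$ satisfies $|p(W')|\ge c\,|W'|$, where $c=1/2^{KT}$. In particular, if the algorithm never fails, then the adversary can build such rows. -/

import Mathlib

namespace OnlineLocalGrid

/-! ### Colours and potential -/

/-- The three colours; `a : Fin 3` stands for colour `a + 1 ∈ {1, 2, 3}`. -/
abbrev Color := Fin 3

/-- The colour as an element of `{1, 2, 3}`. -/
def colorValue (a : Color) : ℤ := (a.val : ℤ) + 1

/-- The potential `p(u, v)` of an edge whose endpoints have colours `a = c(u)` and `b = c(v)`. -/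
def edgePotential (a b : Color) : ℤ :=
  if colorValue a ≠ 3 ∧ colorValue b ≠ 3 then colorValue a - colorValue b else 0

/-- The potential of a walk, given as the list of its consecutive vertices. -/
def potential {V : Type} (c : V → Color) : List V → ℤ
  | [] => 0
  | [_] => 0
  | u :: v :: l => edgePotential (c u) (c v) + potential c (v :: l)

/-- The length (number of edges) of a walk, given as the list of its consecutive vertices. -/
def pathLength {V : Type} (W : List V) : ℕ := W.length - 1

/-! ### The oriented grid -/

/-- Nodes of the `m × m` grid, written as (row, column). -/
abbrev Node (m : ℕ) := Fin m × Fin m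

/-- There is a directed edge from `u` to its eastern neighbour `v`. -/
def IsEast {m : ℕ} (u v : Node m) : Prop := v.1 = u.1 ∧ v.2.val = u.2.val + 1

/-- There is a directed edge from `u` to its southern neighbour `v`. -/
def IsSouth {m : ℕ} (u v : Node m) : Prop := v.1.val = u.1.val + 1 ∧ v.2 = u.2

/-- The underlying undirected graph of the `m × m` oriented grid. -/
def gridGraph (m : ℕ) : SimpleGraph (Node m) :=
  SimpleGraph.fromRel (fun u v => IsEast u v ∨ IsSouth u v)

/-- A (contiguous piece of a) row, as the list of its nodes from west to east. -/
def IsRow {m : ℕ} (R : List (Node m)) : Prop := R.IsChain IsEast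

/-! ### Deterministic online-LOCAL algorithms

All histories are lists with the most recently revealed node first. -/

/-- What an online-LOCAL algorithm sees when it has to label a node: an abstract oriented graph
(every edge knows its cardinal direction), the sequence of revealed nodes (the one to be labelled
is the head of the list) and the labels of the previously revealed nodes. -/
structure View where
  Vertex : Type
  east : Vertex → Vertex → Prop
  south : Vertex → Vertex → Prop
  revealed : List Vertex
  labels : List Color

/-- Isomorphism of views. -/
structure View.Iso (X Y : View) where
  toEquiv : X.Vertex ≃ Y.Vertex
  east_iff : ∀ u v, X.east u v ↔ Y.east (toEquiv u) (toEquiv v)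
  south_iff : ∀ u v, X.south u v ↔ Y.south (toEquiv u) (toEquiv v)
  revealed_eq : X.revealed.map toEquiv = Y.revealed
  labels_eq : X.labels = Y.labels

/-- A deterministic online-LOCAL algorithm: an arbitrary function of the view. Vertices of a view
have no names other than the structure of the view, so isomorphic views get the same output. -/
structure OnlineAlgorithm where
  output : View → Color
  output_iso : ∀ X Y : View, X.Iso Y → output X = output Y

/-- The union of the radius-`T` balls around the nodes of `h`. -/
def viewRegion {m : ℕ} (T : ℕ) (h : List (Node m)) : Set (Node m) :=
  {x | ∃ v ∈ h, (gridGraph m).dist v x ≤ T}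

theorem mem_viewRegion {m : ℕ} (T : ℕ) {h : List (Node m)} {v : Node m} (hv : v ∈ h) :
    v ∈ viewRegion T h :=
  ⟨v, hv, by simp⟩

/-- The view with locality `T` after the nodes `h` of the `m × m` oriented grid have been revealed:
the oriented subgraph induced by the union of the radius-`T` balls. -/
def gridView {m : ℕ} (T : ℕ) (h : List (Node m)) (labels : List Color) : View where
  Vertex := viewRegion T h
  east u v := IsEast u.1 v.1
  south u v := IsSouth u.1 v.1
  revealed := h.attach.map (fun v => ⟨v.1, mem_viewRegion T v.2⟩)
  labels := labels

/-- The labels that `A`, run with locality `T`, assigns along the history `h`. -/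
def OnlineAlgorithm.run {m : ℕ} (A : OnlineAlgorithm) (T : ℕ) : List (Node m) → List Color
  | [] => []
  | v :: past => A.output (gridView T (v :: past) (A.run T past)) :: A.run T past

/-- The colour that `A`, run with locality `T`, has assigned to the node `u` in the history `h`
(the value is meaningless if `u` has not been revealed). -/
def OnlineAlgorithm.color {m : ℕ} (A : OnlineAlgorithm) (T : ℕ) : List (Node m) → Node m → Color
  | [], _ => 0
  | v :: past, u =>
      if u = v then A.output (gridView T (v :: past) (A.run T past)) else A.color T past u

/-- The algorithm has not failed on the history `h`: no two adjacent revealed nodes have the same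
colour. -/
def ProperOn {m : ℕ} (c : Node m → Color) (h : List (Node m)) : Prop :=
  ∀ u ∈ h, ∀ v ∈ h, (gridGraph m).Adj u v → c u ≠ c v

end OnlineLocalGrid

/-!
For a proper colouring the potential behaves like a height function. It vanishes on four-cycles
(`edgePotential_square`), so two parallel row segments at distance `2T + 2` that bound a properly
coloured rectangle have nearly the same potential: the difference comes from the two sides, each
of length `2T + 2` and hence of potential at most `(2T + 4) / 3 ≤ 2T` (`abs_segPotential_le`,
`abs_segPotential_sub_le`).

The adversary exploits that the algorithm does not know the relative position of parts of the
history whose seen regions are disjoint and not adjacent. This is modelled by running the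
algorithm on a stack of disjoint planes; merging two planes at a large enough distance, and
placing a plane in the grid away from the boundary, does not change any colour
(`Host.Transports.color_eq`, `transports_mergePlane`, `transports_gridCoord`).

First, an interval containing a segment of potential at least `k` in absolute value is built by
recursion on `k` (`exists_interval`). Two intervals for `k` are placed in one row, with the space
between them filled. The parity of the potential of the gap between the two segments depends only
on the length of the gap and on the colours of its ends (`segPotential_parity`), so the adversary
can prescribe it by choosing one of two distances. If the segments have opposite signs, a nonzero
gap extends one of them; if they have the same sign, a gap that does not cancel one of them
exactly yields a segment for `k + 1` (`exists_segPotential_succ`). The length of the interval at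
most doubles in each step, up to an additive constant.

Take `k = 4T + 1` and a shortest segment `F` of potential at least `k` in absolute value; up to a
global sign, its proper prefixes have nonnegative potential. Now reveal the row of `N + 1` nodes
in a fresh plane. If some window of the row has a potential smaller by more than `4T` than the
corresponding prefix of `F`, the adversary makes the two parallel and fills the rectangle between
them, and the algorithm fails. Otherwise all windows as long as `F` have potential at least `1`
and all shorter ones at least `-4T`, so that the potential grows linearly along the row
(`exists_history`, `le_abs_segPotential`). Apart from the row, only the interval containing `F`
and possibly the rectangle are revealed; together they have at most `2 ^ (10 * T)` nodes.
-/

namespace OnlineLocalGrid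

/-! ### Histories on oriented graphs -/

/-- An oriented graph on which an online algorithm can be run: `near v x` says that `x` is seen
from `v`, so the locality is part of the data. -/
structure Host (V : Type) where
  east : V → V → Prop
  south : V → V → Prop
  near : V → V → Prop
  near_self : ∀ v, near v v

namespace Host

variable {V W : Type}

/-- The vertices seen from at least one node of the history `h`. -/
def region (X : Host V) (h : List V) : Set V := {x | ∃ v ∈ h, X.near v x}

theorem mem_region (X : Host V) {h : List V} {v : V} (hv : v ∈ h) : v ∈ X.region h :=
  ⟨v, hv, X.near_self v⟩

/-- The view of an algorithm after the history `h` has been revealed. -/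
def view (X : Host V) (h : List V) (labels : List Color) : View where
  Vertex := X.region h
  east u v := X.east u.1 v.1
  south u v := X.south u.1 v.1
  revealed := h.attach.map (fun v => ⟨v.1, X.mem_region v.2⟩)
  labels := labels

/-- The labels assigned by `A` along the history `h`, most recent first. -/
def run (X : Host V) (A : OnlineAlgorithm) : List V → List Color
  | [] => []
  | v :: past => A.output (X.view (v :: past) (X.run A past)) :: X.run A past

/-- The colour of `u` after the history `h`; junk if `u` has not been revealed. -/
def color [DecidableEq V] (X : Host V) (A : OnlineAlgorithm) : List V → V → Color
  | [], _ => 0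
  | v :: past, u =>
      if u = v then A.output (X.view (v :: past) (X.run A past)) else X.color A past u

/-- Adjacent revealed nodes have different colours. -/
def Proper [DecidableEq V] (X : Host V) (A : OnlineAlgorithm) (h : List V) : Prop :=
  ∀ u ∈ h, ∀ v ∈ h, X.east u v ∨ X.south u v → X.color A h u ≠ X.color A h v

theorem color_append_of_notMem [DecidableEq V] (X : Host V) (A : OnlineAlgorithm) {g h : List V}
    {u : V} (hu : u ∉ g) : X.color A (g ++ h) u = X.color A h u := by
  induction g with
  | nil => rfl
  | cons v g ih =>
    simp only [List.mem_cons, not_or] at hu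
    simp [color, hu.1, ih hu.2]

/-- A map of oriented graphs that is an embedding on the seen region and carries the
neighbourhood of each revealed node onto the neighbourhood of its image. -/
structure Transports (X : Host V) (Y : Host W) (f : V → W) (h : List V) : Prop where
  injOn : Set.InjOn f (X.region h)
  east_iff : ∀ u ∈ X.region h, ∀ v ∈ X.region h, X.east u v ↔ Y.east (f u) (f v)
  south_iff : ∀ u ∈ X.region h, ∀ v ∈ X.region h, X.south u v ↔ Y.south (f u) (f v)
  near_iff : ∀ v ∈ h, ∀ y, Y.near (f v) y ↔ ∃ x, X.near v x ∧ f x = y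

variable {X : Host V} {Y : Host W} {f : V → W}

theorem Transports.tail {v : V} {h : List V} (H : Transports X Y f (v :: h)) :
    Transports X Y f h := by
  have hsub : X.region h ⊆ X.region (v :: h) := by
    rintro x ⟨u, hu, hx⟩
    exact ⟨u, List.mem_cons_of_mem _ hu, hx⟩
  exact ⟨H.injOn.mono hsub, fun u hu w hw => H.east_iff u (hsub hu) w (hsub hw),
    fun u hu w hw => H.south_iff u (hsub hu) w (hsub hw),
    fun u hu => H.near_iff u (List.mem_cons_of_mem _ hu)⟩

theorem Transports.output_eq (A : OnlineAlgorithm) {h : List V} (H : Transports X Y f h)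
    (labels : List Color) :
    A.output (X.view h labels) = A.output (Y.view (h.map f) labels) := by
  have hmem : ∀ x : X.region h, f x.1 ∈ Y.region (h.map f) := by
    rintro ⟨x, u, hu, hx⟩
    exact ⟨f u, List.mem_map_of_mem hu, (H.near_iff u hu _).2 ⟨x, hx, rfl⟩⟩
  let F : X.region h → Y.region (h.map f) := fun x => ⟨f x.1, hmem x⟩
  have hF : Function.Bijective F := by
    constructor
    · intro x y hxy
      exact Subtype.ext (H.injOn x.2 y.2 (congrArg Subtype.val hxy))
    · rintro ⟨y, w, hw, hy⟩
      obtain ⟨u, hu, rfl⟩ := List.mem_map.1 hw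
      obtain ⟨x, hx, rfl⟩ := (H.near_iff u hu y).1 hy
      exact ⟨⟨x, u, hu, hx⟩, rfl⟩
  refine A.output_iso _ _ ⟨Equiv.ofBijective F hF, fun u v => H.east_iff _ u.2 _ v.2,
    fun u v => H.south_iff _ u.2 _ v.2, ?_, rfl⟩
  apply List.map_injective_iff.2 Subtype.val_injective
  simp only [view, List.map_map]
  have h1 : (Subtype.val ∘ fun v : {x // x ∈ h.map f} =>
      (⟨v.1, Y.mem_region v.2⟩ : Y.region (h.map f))) = Subtype.val := rfl
  have h2 : (Subtype.val ∘ ⇑(Equiv.ofBijective F hF) ∘ fun v : {x // x ∈ h} =>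
      (⟨v.1, X.mem_region v.2⟩ : X.region h)) = fun v => f v.1 := rfl
  rw [h1]
  refine (congrArg (fun k => List.map k h.attach) h2).trans ?_
  simp only [List.attach_map_val]
  exact (List.attach_map_subtype_val _).symm

theorem Transports.run_eq (A : OnlineAlgorithm) {h : List V} (H : Transports X Y f h) :
    Y.run A (h.map f) = X.run A h := by
  induction h with
  | nil => rfl
  | cons v h ih =>
    have h1 := H.output_eq A (X.run A h)
    rw [List.map_cons] at h1 ⊢
    rw [run, run, ih H.tail, h1]

/-- The algorithm cannot distinguish a history from its transported copy. -/
theorem Transports.color_eq [DecidableEq V] [DecidableEq W] (A : OnlineAlgorithm) {h : List V}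
    (H : Transports X Y f h) {u : V} (hu : u ∈ h) :
    Y.color A (h.map f) (f u) = X.color A h u := by
  induction h with
  | nil => simp at hu
  | cons v h ih =>
    by_cases huv : u = v
    · subst huv
      have h1 := H.output_eq A (X.run A h)
      rw [List.map_cons] at h1
      simp [color, H.tail.run_eq A, h1]
    · have hu' : u ∈ h := (List.mem_cons.1 hu).resolve_left huv
      have hne : f u ≠ f v := fun e =>
        huv (H.injOn (X.mem_region hu) (X.mem_region List.mem_cons_self) e)
      simp [color, huv, hne, ih H.tail hu']

end Host

/-! ### Potentials of colour sequences -/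

/-- The potential of the walk through the positions `a, a + 1, …, a + n` of a colour sequence. -/
def segPotential (f : ℕ → Color) (a n : ℕ) : ℤ :=
  ∑ j ∈ Finset.range n, edgePotential (f (a + j)) (f (a + j + 1))

theorem segPotential_succ (f : ℕ → Color) (a n : ℕ) :
    segPotential f a (n + 1) =
      segPotential f a n + edgePotential (f (a + n)) (f (a + n + 1)) :=
  Finset.sum_range_succ _ _

theorem segPotential_add (f : ℕ → Color) (a n k : ℕ) :
    segPotential f a (n + k) = segPotential f a n + segPotential f (a + n) k := by
  simp [segPotential, Finset.sum_range_add, add_assoc]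

theorem segPotential_congr {f g : ℕ → Color} {a b n : ℕ}
    (hfg : ∀ j ≤ n, f (a + j) = g (b + j)) : segPotential f a n = segPotential g b n := by
  refine Finset.sum_congr rfl fun j hj => ?_
  have hj := Finset.mem_range.1 hj
  rw [hfg j hj.le, add_assoc, hfg (j + 1) hj, add_assoc]

/-- The indicator of the third colour. -/
def isThird (a : Color) : ℤ := if a = 2 then 1 else 0

/-- The parity of the potential of a properly coloured walk is determined by its length and its
end colours. -/
theorem segPotential_parity (f : ℕ → Color) (a n : ℕ)
    (hf : ∀ j < n, f (a + j) ≠ f (a + j + 1)) :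
    Even (segPotential f a n + n + isThird (f a) + isThird (f (a + n))) := by
  have key : ∀ x y : Color, x ≠ y → Even (edgePotential x y + 1 + isThird x + isThird y) := by
    decide
  induction n with
  | zero =>
    simp only [segPotential, Finset.range_zero, Finset.sum_empty, Nat.cast_zero, add_zero, zero_add]
    exact ⟨_, rfl⟩
  | succ n ih =>
    have h1 := ih fun j hj => hf j (by omega)
    have h2 := key _ _ (hf n (by omega))
    rw [segPotential_succ, ← add_assoc]
    rw [Int.even_iff] at *
    push_cast
    omega

/-- A properly coloured walk of length `n` has potential at most `(n + 2) / 3`: up to a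
correction depending on the end colours, three times the potential of an edge is `±1`. -/
theorem abs_segPotential_le (f : ℕ → Color) (a n : ℕ)
    (hf : ∀ j < n, f (a + j) ≠ f (a + j + 1)) : 3 * |segPotential f a n| ≤ n + 2 := by
  -- `ψ` is chosen so that `3 p(x, y) - ψ x + ψ y = ±1` for any two distinct colours
  let ψ : Color → ℤ := ![0, 2, 1]
  have key : ∀ x y : Color, x ≠ y → |3 * edgePotential x y - ψ x + ψ y| ≤ 1 := by decide
  have hψ : ∀ x y : Color, |ψ x - ψ y| ≤ 2 := by decide
  have main : |3 * segPotential f a n - ψ (f a) + ψ (f (a + n))| ≤ n := by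
    induction n with
    | zero => simp [segPotential]
    | succ n ih =>
      have h1 := ih fun j hj => hf j (by omega)
      have h2 := key _ _ (hf n (by omega))
      rw [segPotential_succ, ← add_assoc]
      rw [abs_le] at *
      push_cast
      omega
  have h3 := hψ (f a) (f (a + n))
  rw [abs_le] at main h3
  have : |3 * segPotential f a n| ≤ n + 2 := abs_le.2 ⟨by omega, by omega⟩
  rwa [abs_mul] at this

/-- A properly coloured four-cycle has potential zero. -/
theorem edgePotential_square : ∀ a b c d : Color, a ≠ b → b ≠ d → a ≠ c → c ≠ d →
    edgePotential a b + edgePotential b d = edgePotential a c + edgePotential c d := by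
  decide

/-- Two parallel rows of a properly coloured rectangle: the difference of their potentials is the
difference of the potentials of the two sides. -/
theorem segPotential_sub_eq (c : ℕ → ℕ → Color) (a n D : ℕ)
    (hrow : ∀ r ≤ D, ∀ j < n, c r (a + j) ≠ c r (a + j + 1))
    (hcol : ∀ r < D, ∀ j ≤ n, c r (a + j) ≠ c (r + 1) (a + j)) :
    segPotential (c 0) a n - segPotential (c D) a n =
      segPotential (fun r => c r a) 0 D - segPotential (fun r => c r (a + n)) 0 D := by
  have step : ∀ r < D, ∀ k ≤ n, segPotential (c r) a k - segPotential (c (r + 1)) a k =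
      edgePotential (c r a) (c (r + 1) a) - edgePotential (c r (a + k)) (c (r + 1) (a + k)) := by
    intro r hr k hk
    induction k with
    | zero => simp [segPotential]
    | succ k ih =>
      have h1 := ih (by omega)
      have h2 := edgePotential_square (c r (a + k)) (c r (a + k + 1)) (c (r + 1) (a + k))
        (c (r + 1) (a + k + 1)) (hrow r hr.le k hk) (hcol r hr (k + 1) hk)
        (hcol r hr k (by omega)) (hrow (r + 1) hr k hk)
      rw [segPotential_succ, segPotential_succ, ← add_assoc]
      linarith
  have main : ∀ E ≤ D, segPotential (c 0) a n - segPotential (c E) a n =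
      segPotential (fun r => c r a) 0 E - segPotential (fun r => c r (a + n)) 0 E := by
    intro E hE
    induction E with
    | zero => simp [segPotential]
    | succ E ih =>
      have h1 := ih (by omega)
      have h2 := step E hE n le_rfl
      rw [segPotential_succ, segPotential_succ]
      simp only [zero_add]
      linarith
  exact main D le_rfl

theorem abs_segPotential_sub_le (c : ℕ → ℕ → Color) (a n T : ℕ) (hT : 1 ≤ T)
    (hrow : ∀ r ≤ 2 * T + 2, ∀ j < n, c r (a + j) ≠ c r (a + j + 1))
    (hcol : ∀ r < 2 * T + 2, ∀ j ≤ n, c r (a + j) ≠ c (r + 1) (a + j)) :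
    |segPotential (c 0) a n - segPotential (c (2 * T + 2)) a n| ≤ 4 * T := by
  have h0 := segPotential_sub_eq c a n (2 * T + 2) hrow hcol
  have h1 := abs_segPotential_le (fun r => c r a) 0 (2 * T + 2)
    (fun j hj => by simpa using hcol j hj 0 (by omega))
  have h2 := abs_segPotential_le (fun r => c r (a + n)) 0 (2 * T + 2)
    (fun j hj => by simpa using hcol j hj n le_rfl)
  have h3 := abs_le.1 (le_refl |segPotential (fun r => c r a) 0 (2 * T + 2)|)
  have h4 := abs_le.1 (le_refl |segPotential (fun r => c r (a + n)) 0 (2 * T + 2)|)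
  push_cast at h1 h2
  rw [h0, abs_le]
  constructor <;> omega

/-- Two segments of potential at least `k` in absolute value, separated by a gap: if the
potential of the gap has the right parity, some segment of the concatenation has potential at
least `k + 1` in absolute value. The parity is `k + 1` if the two potentials have the same sign,
and odd otherwise. -/
theorem exists_segPotential_succ (f : ℕ → Color) (a₁ n₁ g n₂ k : ℕ)
    (h₁ : (k : ℤ) ≤ |segPotential f a₁ n₁|) (h₂ : (k : ℤ) ≤ |segPotential f (a₁ + n₁ + g) n₂|)
    (hg : Even (segPotential f (a₁ + n₁) g +
      if 0 ≤ segPotential f a₁ n₁ ↔ 0 ≤ segPotential f (a₁ + n₁ + g) n₂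
      then (k : ℤ) + 1 else 1)) :
    ∃ a n, a + n ≤ a₁ + n₁ + g + n₂ ∧ ((k + 1 : ℕ) : ℤ) ≤ |segPotential f a n| := by
  have e1 := segPotential_add f a₁ n₁ g
  have e2 := segPotential_add f (a₁ + n₁) g n₂
  have e3 := segPotential_add f a₁ (n₁ + g) n₂
  rw [← add_assoc] at e3
  by_contra! hc
  have c1 := hc a₁ (n₁ + g) (by omega)
  have c2 := hc (a₁ + n₁) (g + n₂) (by omega)
  have c3 := hc a₁ (n₁ + g + n₂) (by omega)
  have c4 := hc (a₁ + n₁) g (by omega)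
  rw [Int.even_iff] at hg
  push_cast at c1 c2 c3 c4
  rw [abs_lt] at c1 c2 c3 c4
  rw [le_abs] at h₁ h₂
  split_ifs at hg with hs <;> omega

/-- If all segments of length `n` have potential at least `1`, and all shorter ones at least
`-4T`, with respect to a fixed sign, then the potential of long segments grows linearly. -/
theorem le_abs_segPotential (f : ℕ → Color) (σ : ℤ) (hσ : |σ| = 1) (n N T M : ℕ) (hT : 1 ≤ T)
    (hn : 1 ≤ n) (hM : 6 * T * n ≤ M)
    (hlong : ∀ x, x + n ≤ N → 1 ≤ σ * segPotential f x n)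
    (hshort : ∀ x r, r < n → x + r ≤ N → -(4 * T : ℤ) ≤ σ * segPotential f x r)
    (x len : ℕ) (hx : x + len ≤ N) (hlen : M ≤ len) :
    (len : ℤ) ≤ M * |segPotential f x len| := by
  have hmul : ∀ q x, x + q * n ≤ N → (q : ℤ) ≤ σ * segPotential f x (q * n) := by
    intro q
    induction q with
    | zero => intro x _; simp [segPotential]
    | succ q ih =>
      intro x hx
      rw [Nat.succ_mul] at hx ⊢
      have h1 := ih x (by omega)
      have h2 := hlong (x + q * n) (by omega)
      rw [segPotential_add, mul_add]
      push_cast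
      linarith
  set q := len / n with hq
  have hdm : q * n + len % n = len := by rw [mul_comm]; exact Nat.div_add_mod len n
  have hr : len % n < n := Nat.mod_lt _ hn
  have h1 := hmul q x (by omega)
  have h2 := hshort (x + q * n) (len % n) hr (by omega)
  have h3 : (q : ℤ) - 4 * T ≤ σ * segPotential f x len := by
    rw [← hdm, segPotential_add, mul_add]
    linarith
  have h4 : σ * segPotential f x len ≤ |segPotential f x len| := by
    calc _ ≤ |σ * segPotential f x len| := le_abs_self _
      _ = _ := by rw [abs_mul, hσ, one_mul]
  -- since `q ≥ 6T`, the loss of `4T` in the remainder leaves at least `q / 3 ≥ (q + 1) / 6`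
  have hq6 : 6 * T ≤ q := (Nat.le_div_iff_mul_le hn).2 (hM.trans hlen)
  have h5 : (q : ℤ) + 1 ≤ 6 * |segPotential f x len| := by omega
  have h6 : (len : ℤ) ≤ (q + 1) * n := by
    have : len ≤ (q + 1) * n := by rw [Nat.succ_mul]; omega
    exact_mod_cast this
  have h7 : (6 * n : ℤ) ≤ M := by
    have : 6 * n ≤ 6 * T * n := Nat.mul_le_mul_right n (by omega)
    exact_mod_cast this.trans hM
  calc (len : ℤ) ≤ (q + 1) * n := h6
    _ ≤ 6 * |segPotential f x len| * n := by gcongr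
    _ = 6 * n * |segPotential f x len| := by ring
    _ ≤ M * |segPotential f x len| := by gcongr

/-! ### A stack of planes -/

/-- Points of a stack of disjoint planes, written as (plane, row, column). Parts of a history that
lie in different planes have no fixed relative position. -/
abbrev Pt := ℕ × ℤ × ℤ

/-- The disjoint union of oriented planes, seen with locality `T`. -/
def planeHost (T : ℕ) : Host Pt where
  east u v := v.1 = u.1 ∧ v.2.1 = u.2.1 ∧ v.2.2 = u.2.2 + 1
  south u v := v.1 = u.1 ∧ v.2.1 = u.2.1 + 1 ∧ v.2.2 = u.2.2
  near u v := v.1 = u.1 ∧ (v.2.1 - u.2.1).natAbs + (v.2.2 - u.2.2).natAbs ≤ T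
  near_self v := by simp

/-- The nodes of a rectangle in plane `i` with north-west corner `(r, c)`, `D` rows and `L`
columns. -/
def block (i : ℕ) (r c : ℤ) (D L : ℕ) : List Pt :=
  (List.range D ×ˢ List.range L).map fun x => (i, r + x.1, c + x.2)

theorem length_block (i : ℕ) (r c : ℤ) (D L : ℕ) : (block i r c D L).length = D * L := by
  simp [block, List.length_product]

theorem nodup_block (i : ℕ) (r c : ℤ) (D L : ℕ) : (block i r c D L).Nodup := by
  refine List.Nodup.map ?_ (List.nodup_range.product List.nodup_range)
  rintro ⟨a, b⟩ ⟨a', b'⟩ hab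
  simpa using hab

theorem mem_block {i : ℕ} {r c : ℤ} {D L : ℕ} {q : Pt} :
    q ∈ block i r c D L ↔
      q.1 = i ∧ r ≤ q.2.1 ∧ q.2.1 < r + D ∧ c ≤ q.2.2 ∧ q.2.2 < c + L := by
  obtain ⟨p, x, y⟩ := q
  simp only [block, List.mem_map, Prod.exists, List.mem_product, List.mem_range,
    Prod.mk.injEq]
  constructor
  · rintro ⟨a, b, ⟨ha, hb⟩, rfl, rfl, rfl⟩
    omega
  · rintro ⟨rfl, h1, h2, h3, h4⟩
    exact ⟨(x - r).toNat, (y - c).toNat, ⟨by omega, by omega⟩, rfl, by omega, by omega⟩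

/-- Move plane `i + 1` onto plane `i`, with a translation by `(dr, dc)`. -/
def mergePlane (i : ℕ) (dr dc : ℤ) (q : Pt) : Pt :=
  if q.1 = i + 1 then (i, q.2.1 + dr, q.2.2 + dc) else q

theorem mergePlane_of_eq {i : ℕ} (dr dc x y : ℤ) :
    mergePlane i dr dc (i + 1, x, y) = (i, x + dr, y + dc) := if_pos rfl

theorem mergePlane_of_ne {i : ℕ} (dr dc : ℤ) {q : Pt} (hq : q.1 ≠ i + 1) :
    mergePlane i dr dc q = q := if_neg hq

/-- As long as the merged pieces stay at distance at least `2T + 2`, the algorithm cannot tell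
that two planes have been merged: no edge joins the two seen regions. -/
theorem transports_mergePlane {T i : ℕ} {dr dc : ℤ} {h : List Pt}
    (hsep : ∀ u ∈ h, ∀ v ∈ h, u.1 = i → v.1 = i + 1 →
      2 * T + 2 ≤ (v.2.1 + dr - u.2.1).natAbs + (v.2.2 + dc - u.2.2).natAbs) :
    (planeHost T).Transports (planeHost T) (mergePlane i dr dc) h := by
  have far : ∀ x ∈ (planeHost T).region h, ∀ y ∈ (planeHost T).region h, x.1 = i →
      y.1 = i + 1 → 2 ≤ (y.2.1 + dr - x.2.1).natAbs + (y.2.2 + dc - x.2.2).natAbs := by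
    rintro x ⟨u, hu, hx, hx'⟩ y ⟨v, hv, hy, hy'⟩ hxi hyi
    have := hsep u hu v hv (by omega) (by omega)
    omega
  have hrel : ∀ e s : ℤ, e.natAbs + s.natAbs ≤ 1 → ∀ x ∈ (planeHost T).region h,
      ∀ y ∈ (planeHost T).region h,
      ((y.1 = x.1 ∧ y.2.1 = x.2.1 + s ∧ y.2.2 = x.2.2 + e) ↔
        ((mergePlane i dr dc y).1 = (mergePlane i dr dc x).1 ∧
          (mergePlane i dr dc y).2.1 = (mergePlane i dr dc x).2.1 + s ∧
          (mergePlane i dr dc y).2.2 = (mergePlane i dr dc x).2.2 + e)) := by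
    intro e s hes x hx y hy
    have h1 := far x hx y hy
    have h2 := far y hy x hx
    unfold mergePlane
    split_ifs with hyi hxi hxi <;> simp only [true_and] <;> omega
  refine ⟨?_, ?_, ?_, ?_⟩
  · intro x hx y hy hxy
    have := (hrel 0 0 (by simp) x hx y hy).2 (by simp [hxy])
    refine Prod.ext this.1.symm (Prod.ext ?_ ?_) <;> omega
  · intro u hu v hv
    simpa [planeHost] using hrel 1 0 (by simp) u hu v hv
  · intro u hu v hv
    simpa [planeHost] using hrel 0 1 (by simp) u hu v hv
  · rintro ⟨p, x, y⟩ - ⟨p', x', y'⟩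
    simp only [planeHost]
    by_cases hp : p = i + 1
    · subst hp
      rw [mergePlane_of_eq]
      constructor
      · rintro ⟨h1, h2⟩
        refine ⟨(i + 1, x' - dr, y' - dc), ⟨rfl, by simp only at h2 ⊢; omega⟩, ?_⟩
        rw [mergePlane_of_eq]
        simp only at h1
        simp [h1]
      · rintro ⟨⟨p₂, x₂, y₂⟩, ⟨h1, h2⟩, h3⟩
        simp only at h1 h2
        subst h1
        rw [mergePlane_of_eq] at h3
        simp only [Prod.mk.injEq] at h3 ⊢
        omega
    · rw [mergePlane_of_ne _ _ (by exact hp)]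
      constructor
      · rintro ⟨h1, h2⟩
        refine ⟨(p', x', y'), ⟨h1, h2⟩, mergePlane_of_ne _ _ ?_⟩
        simp only at h1 ⊢
        omega
      · rintro ⟨⟨p₂, x₂, y₂⟩, ⟨h1, h2⟩, h3⟩
        simp only at h1 h2
        subst h1
        rw [mergePlane_of_ne _ _ (by exact hp)] at h3
        simp only [Prod.mk.injEq] at h3 ⊢
        omega

/-! ### Forcing a segment of large potential -/

/-- The colours along row `r` of plane `i`, from column `0` eastwards. -/
def rowColor (A : OnlineAlgorithm) (T : ℕ) (h : List Pt) (i : ℕ) (r : ℤ) (j : ℕ) : Color :=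
  (planeHost T).color A h (i, r, j)

/-- In any fresh plane the adversary can reveal an interval of a row, of length exponential in
`k`, that contains a segment of potential at least `k` in absolute value unless the algorithm
fails. Two such intervals are joined into the next one; the distance between them is chosen from
`2T + 2` and `2T + 3` so that the potential of the gap gets the parity required by
`exists_segPotential_succ`. -/
theorem exists_interval (A : OnlineAlgorithm) (T k : ℕ) : ∀ (i : ℕ) (h : List Pt),
    (∀ q ∈ h, q.1 < i) → ∃ (w : ℕ) (g : List Pt), 1 ≤ w ∧
      w + (2 * T + 2) ≤ 2 ^ k * (2 * T + 3) ∧ g.Perm (block i 0 0 1 w) ∧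
      ∃ a n : ℕ, a + n < w ∧
        ((∀ j, j + 1 < w → rowColor A T (g ++ h) i 0 j ≠ rowColor A T (g ++ h) i 0 (j + 1)) →
          (k : ℤ) ≤ |segPotential (rowColor A T (g ++ h) i 0) a n|) := by
  induction k with
  | zero =>
    intro i h _
    exact ⟨1, block i 0 0 1 1, le_rfl, by omega, List.Perm.refl _, 0, 0, by simp,
      fun _ => by simp⟩
  | succ k ih =>
    intro i h hh
    obtain ⟨w₁, g₁, hw₁, hw₁', hg₁, a₁, n₁, han₁, hp₁⟩ := ih i h hh
    have mem₁ : ∀ q, q ∈ g₁ ↔ q.1 = i ∧ q.2.1 = 0 ∧ 0 ≤ q.2.2 ∧ q.2.2 < w₁ := by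
      intro q
      rw [hg₁.mem_iff, mem_block]
      push_cast
      omega
    obtain ⟨w₂, g₂, hw₂, hw₂', hg₂, a₂, n₂, han₂, hp₂⟩ := ih (i + 1) (g₁ ++ h) (by
      intro q hq
      rcases List.mem_append.1 hq with hq | hq
      · have := ((mem₁ q).1 hq).1
        omega
      · have := hh q hq
        omega)
    have mem₂ : ∀ q, q ∈ g₂ ↔ q.1 = i + 1 ∧ q.2.1 = 0 ∧ 0 ≤ q.2.2 ∧ q.2.2 < w₂ := by
      intro q
      rw [hg₂.mem_iff, mem_block]
      push_cast
      omega
    set C₁ := rowColor A T (g₁ ++ h) i 0 with hC₁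
    set C₂ := rowColor A T (g₂ ++ (g₁ ++ h)) (i + 1) 0 with hC₂
    -- the parity that the potential of the gap should have
    set t : ℤ := if 0 ≤ segPotential C₁ a₁ n₁ ↔ 0 ≤ segPotential C₂ a₂ n₂
      then (k : ℤ) + 1 else 1 with ht
    obtain ⟨d, hd1, hd2, hd⟩ : ∃ d : ℕ, 2 * T + 2 ≤ d ∧ d ≤ 2 * T + 3 ∧
        Even (((w₁ - 1 + d + a₂ - (a₁ + n₁) : ℕ) : ℤ) + isThird (C₁ (a₁ + n₁)) +
          isThird (C₂ a₂) + t) := by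
      simp only [Int.even_iff]
      by_cases hpar : (((w₁ - 1 + (2 * T + 2) + a₂ - (a₁ + n₁) : ℕ) : ℤ) +
          isThird (C₁ (a₁ + n₁)) + isThird (C₂ a₂) + t) % 2 = 0
      · exact ⟨2 * T + 2, le_rfl, by omega, hpar⟩
      · exact ⟨2 * T + 3, by omega, le_rfl, by omega⟩
    -- the column to which the west end of the second interval is moved
    set s : ℕ := w₁ - 1 + d with hs
    set F := mergePlane i 0 s with hF
    -- the nodes strictly between the two intervals
    set B := block i 0 w₁ 1 (d - 1) with hB
    have memB : ∀ q, q ∈ B ↔ q.1 = i ∧ q.2.1 = 0 ∧ (w₁ : ℤ) ≤ q.2.2 ∧ q.2.2 < s := by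
      intro q
      rw [hB, mem_block]
      push_cast
      omega
    have hFid : ∀ l : List Pt, (∀ q ∈ l, q.1 < i + 1) → l.map F = l := by
      intro l hl
      conv_rhs => rw [← List.map_id l]
      exact List.map_congr_left fun q hq =>
        mergePlane_of_ne _ _ (by have := hl q hq; omega)
    have hg₁F : g₁.map F = g₁ := hFid _ fun q hq => by have := (mem₁ q).1 hq; omega
    have hhF : h.map F = h := hFid _ fun q hq => by have := hh q hq; omega
    have mem₂F : ∀ q, q ∈ g₂.map F ↔
        q.1 = i ∧ q.2.1 = 0 ∧ (s : ℤ) ≤ q.2.2 ∧ q.2.2 < s + w₂ := by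
      rintro ⟨p, x, y⟩
      simp only [List.mem_map, mem₂, Prod.exists]
      constructor
      · rintro ⟨p', x', y', ⟨rfl, h1, h2, h3⟩, h4⟩
        rw [hF, mergePlane_of_eq] at h4
        simp only [Prod.mk.injEq] at h4
        omega
      · rintro ⟨rfl, rfl, h1, h2⟩
        refine ⟨p + 1, 0, y - s, ⟨rfl, rfl, by omega, by omega⟩, ?_⟩
        rw [hF, mergePlane_of_eq]
        simp
    have hFinj : Set.InjOn F {q | q ∈ g₂} := by
      rintro ⟨p, x, y⟩ hq ⟨p', x', y'⟩ hq' heq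
      obtain rfl := ((mem₂ _).1 hq).1
      obtain rfl := ((mem₂ _).1 hq').1
      rw [hF, mergePlane_of_eq, mergePlane_of_eq] at heq
      simpa using heq
    have htr : (planeHost T).Transports (planeHost T) F (g₂ ++ (g₁ ++ h)) := by
      refine transports_mergePlane ?_
      intro u hu v hv hui hvi
      simp only [List.mem_append, mem₁, mem₂] at hu hv
      have hu' : u ∉ h := fun hc => by have := hh u hc; omega
      have hv' : v ∉ h := fun hc => by have := hh v hc; omega
      simp only [hu', hv', or_false] at hu hv
      omega
    set G := B ++ (g₂.map F ++ g₁) with hG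
    have hGh : G ++ h = B ++ (g₂ ++ (g₁ ++ h)).map F := by
      rw [List.map_append, List.map_append, hg₁F, hhF, hG]
      simp
    set C := rowColor A T (G ++ h) i 0 with hC
    have hCC₁ : ∀ j < w₁, C j = C₁ j := by
      intro j hj
      have hm : ((i, 0, (j : ℤ)) : Pt) ∈ g₁ := (mem₁ _).2 ⟨rfl, rfl, by simp, by simpa using hj⟩
      have e := htr.color_eq A (List.mem_append_right g₂ (List.mem_append_left h hm))
      rw [hF, mergePlane_of_ne _ _ (by simp), ← hF] at e
      rw [hC, hC₁, rowColor, rowColor, hGh, Host.color_append_of_notMem, e,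
        Host.color_append_of_notMem]
      · rw [mem₂]; simp
      · rw [memB]; simp; omega
    have hCC₂ : ∀ j < w₂, C (s + j) = C₂ j := by
      intro j hj
      have hm : ((i + 1, 0, (j : ℤ)) : Pt) ∈ g₂ :=
        (mem₂ _).2 ⟨rfl, rfl, by simp, by simpa using hj⟩
      have e := htr.color_eq A (List.mem_append_left (g₁ ++ h) hm)
      rw [hF, mergePlane_of_eq, ← hF] at e
      rw [hC, hC₂, rowColor, rowColor, hGh, Host.color_append_of_notMem, ← e]
      · congr 3
        push_cast
        ring
      · rw [memB]; simp
    have hGperm : G.Perm (block i 0 0 1 (s + w₂)) := by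
      refine (List.perm_ext_iff_of_nodup ?_ (nodup_block ..)).2 ?_
      · have hn₂ : (g₂.map F).Nodup :=
          List.Nodup.map_on (fun x hx y hy e => hFinj hx hy e) (hg₂.nodup_iff.2 (nodup_block ..))
        rw [hG, List.nodup_append', List.nodup_append']
        refine ⟨nodup_block .., ⟨hn₂, hg₁.nodup_iff.2 (nodup_block ..), ?_⟩, ?_⟩
        · intro q hq hq'
          rw [mem₂F] at hq
          rw [mem₁] at hq'
          omega
        · intro q hq hq'
          rw [memB] at hq
          rw [List.mem_append, mem₂F, mem₁] at hq'
          omega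
      · intro q
        rw [hG, List.mem_append, List.mem_append, memB, mem₂F, mem₁, mem_block]
        push_cast
        omega
    refine ⟨s + w₂, G, by omega, ?_, hGperm, ?_⟩
    · rw [pow_succ, mul_right_comm]
      omega
    by_cases hprop : ∀ j, j + 1 < s + w₂ → C j ≠ C (j + 1)
    · have hP₁ : (k : ℤ) ≤ |segPotential C₁ a₁ n₁| := hp₁ fun j hj => by
        rw [← hCC₁ j (by omega), ← hCC₁ (j + 1) hj]
        exact hprop j (by omega)
      have hP₂ : (k : ℤ) ≤ |segPotential C₂ a₂ n₂| := hp₂ fun j hj => by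
        rw [← hCC₂ j (by omega), ← hCC₂ (j + 1) hj, ← add_assoc]
        exact hprop (s + j) (by omega)
      have hgap : a₁ + n₁ + (s + a₂ - (a₁ + n₁)) = s + a₂ := by omega
      have e₁ : segPotential C a₁ n₁ = segPotential C₁ a₁ n₁ :=
        segPotential_congr fun j hj => hCC₁ _ (by omega)
      have e₂ : segPotential C (s + a₂) n₂ = segPotential C₂ a₂ n₂ :=
        segPotential_congr fun j hj => by rw [add_assoc]; exact hCC₂ _ (by omega)
      have hpar := segPotential_parity C (a₁ + n₁) (s + a₂ - (a₁ + n₁))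
        fun j hj => hprop _ (by omega)
      rw [hgap, hCC₁ _ han₁, hCC₂ _ (by omega : a₂ < w₂)] at hpar
      obtain ⟨a, n, han, hk⟩ := exists_segPotential_succ C a₁ n₁ (s + a₂ - (a₁ + n₁)) n₂ k
        (by rwa [e₁]) (by rwa [hgap, e₂]) (by
          rw [hgap, e₁, e₂, ← ht]
          rw [Int.even_iff] at hpar hd ⊢
          omega)
      exact ⟨a, n, by omega, fun _ => hk⟩
    · exact ⟨0, 0, by omega, fun hc => absurd hc hprop⟩

/-! ### The adversary on the planes -/

/-- With `2 ^ (4 * T + 1) * (2 * T + 3)` bounding the length of the prepared interval: the interval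
and the filled rectangle fit into the budget, and a window of length `2 ^ (10 * T)` contains at
least `6 * T` disjoint copies of the segment. -/
theorem two_pow_bound {T : ℕ} (hT : 1 ≤ T) :
    2 ^ (4 * T + 1) * (2 * T + 3) * (2 * T + 2) ≤ 2 ^ (10 * T) ∧
      6 * T * (2 ^ (4 * T + 1) * (2 * T + 3)) ≤ 2 ^ (10 * T) := by
  have h : 2 * (2 * T + 3) * (2 * T + 2) ≤ 64 ^ T ∧ 12 * T * (2 * T + 3) ≤ 64 ^ T := by
    induction T, hT using Nat.le_induction with
    | base => norm_num
    | succ T hT ih =>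
      rw [pow_succ]
      constructor <;> nlinarith
  have e1 : (2 : ℕ) ^ (4 * T + 1) = 16 ^ T * 2 := by rw [pow_succ, pow_mul]; norm_num
  have e2 : (2 : ℕ) ^ (10 * T) = 16 ^ T * 64 ^ T := by rw [pow_mul, ← mul_pow]; norm_num
  rw [e1, e2]
  constructor
  · calc _ = 16 ^ T * (2 * (2 * T + 3) * (2 * T + 2)) := by ring
      _ ≤ _ := Nat.mul_le_mul_left _ h.1
  · calc _ = 16 ^ T * (12 * T * (2 * T + 3)) := by ring
      _ ≤ _ := Nat.mul_le_mul_left _ h.2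

/-- A shortest segment of potential at least `k` in absolute value: with respect to a suitable
sign all of its proper prefixes have nonnegative potential. -/
theorem exists_minimal_segment (f : ℕ → Color) (w k : ℕ)
    (h : ∃ a n, a + n < w ∧ (k : ℤ) ≤ |segPotential f a n|) :
    ∃ (σ : ℤ) (a n : ℕ), |σ| = 1 ∧ a + n < w ∧ (k : ℤ) ≤ σ * segPotential f a n ∧
      ∀ r < n, 0 ≤ σ * segPotential f a r := by
  classical
  have h' : ∃ n a, a + n < w ∧ (k : ℤ) ≤ |segPotential f a n| := by
    obtain ⟨a, n, h⟩ := h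
    exact ⟨n, a, h⟩
  obtain ⟨a, han, hk⟩ := Nat.find_spec h'
  set n := Nat.find h'
  have hmin : ∀ r < n, ∀ b, b + r < w → |segPotential f b r| < k := by
    intro r hr b hb
    by_contra! hc
    exact Nat.find_min h' hr ⟨b, hb, hc⟩
  obtain ⟨σ, hσ, hσ'⟩ : ∃ σ : ℤ, |σ| = 1 ∧ |segPotential f a n| = σ * segPotential f a n := by
    rcases abs_choice (segPotential f a n) with h | h
    · exact ⟨1, by simp, by simpa using h⟩
    · exact ⟨-1, by simp, by simpa using h⟩
  refine ⟨σ, a, n, hσ, han, hσ' ▸ hk, fun r hr => ?_⟩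
  rcases Nat.eq_zero_or_pos r with rfl | hr0
  · simp [segPotential]
  have h1 := segPotential_add f a r (n - r)
  rw [Nat.add_sub_cancel' hr.le] at h1
  have h2 := hmin (n - r) (by omega) (a + r) (by omega)
  have h3 : σ * segPotential f (a + r) (n - r) ≤ |segPotential f (a + r) (n - r)| := by
    calc _ ≤ |σ * segPotential f (a + r) (n - r)| := le_abs_self _
      _ = _ := by rw [abs_mul, hσ, one_mul]
  rw [hσ', h1, mul_add] at hk
  linarith

/-- The adversary's strategy on the planes. A segment of potential at least `4T + 1` is prepared
in one plane and a row of length `N` is revealed in another one. If the potential along some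
window of the row is much smaller than along the corresponding part of the segment, the planes
are merged so that the two are parallel, at distance `2T + 2`, and the rectangle between them
is filled, which cannot be done properly. Otherwise the planes are merged anyhow. -/
theorem exists_history (A : OnlineAlgorithm) (T N : ℕ) (hT : 1 ≤ T) :
    ∃ (h : List Pt) (lo s : ℤ), h.Nodup ∧ h.length ≤ (N + 1) + 2 ^ (10 * T) ∧
      (∀ q ∈ h, q.1 = 0 ∧ 0 ≤ q.2.1 ∧ q.2.1 ≤ 2 * T + 2 ∧ lo ≤ q.2.2 ∧
        q.2.2 + 2 * T < lo + ((N + 1 + 2 ^ (10 * T) : ℕ) : ℤ)) ∧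
      (∀ j ≤ N, ((0, 2 * T + 2, s + (j : ℕ)) : Pt) ∈ h) ∧
      ((planeHost T).Proper A h → ∀ x len, x + len ≤ N → 2 ^ (10 * T) ≤ len →
        (len : ℤ) ≤ ((2 ^ (10 * T) : ℕ) : ℤ) * |segPotential
          (fun j => (planeHost T).color A h (0, 2 * T + 2, s + (j : ℕ))) x len|) := by
  obtain ⟨w, g, hw, hwk, hg, a₀, n₀, han₀, hseg⟩ :=
    exists_interval A T (4 * T + 1) 0 [] (by simp)
  obtain ⟨hb1, hb2⟩ := two_pow_bound hT
  set M := 2 ^ (10 * T) with hM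
  have hwM : w * (2 * T + 2) + (2 * T + 2) ≤ M := by
    have h1 : (w + (2 * T + 2)) * (2 * T + 2) ≤ M := (Nat.mul_le_mul_right _ hwk).trans hb1
    nlinarith
  rw [List.append_nil] at hseg
  set C := rowColor A T g 0 0 with hC
  set R := block 1 0 0 1 (N + 1) with hR
  set D := rowColor A T (R ++ g) 1 0 with hD
  have memg : ∀ q, q ∈ g ↔ q.1 = 0 ∧ q.2.1 = 0 ∧ 0 ≤ q.2.2 ∧ q.2.2 < w := by
    intro q
    rw [hg.mem_iff, mem_block]
    push_cast
    omega
  have memR : ∀ q, q ∈ R ↔ q.1 = 1 ∧ q.2.1 = 0 ∧ 0 ≤ q.2.2 ∧ q.2.2 ≤ N := by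
    intro q
    rw [hR, mem_block]
    push_cast
    omega
  -- the merged history, in which the row starts in column `s`
  let H : ℤ → List Pt := fun s => (R ++ g).map (mergePlane 0 (2 * T + 2) s)
  have memH : ∀ s q, q ∈ H s ↔ q.1 = 0 ∧ (q.2.1 = 0 ∧ 0 ≤ q.2.2 ∧ q.2.2 < w ∨
      q.2.1 = 2 * T + 2 ∧ s ≤ q.2.2 ∧ q.2.2 ≤ s + N) := by
    rintro s ⟨p, x, y⟩
    simp only [H, List.mem_map, List.mem_append, memg, memR, Prod.exists]
    constructor
    · rintro ⟨p', x', y', ⟨rfl, h1⟩ | ⟨rfl, h1⟩, h2⟩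
      · rw [mergePlane_of_eq] at h2
        simp only [Prod.mk.injEq] at h2
        omega
      · rw [mergePlane_of_ne _ _ (by simp)] at h2
        simp only [Prod.mk.injEq] at h2
        omega
    · rintro ⟨rfl, h1 | h1⟩
      · exact ⟨0, x, y, Or.inr ⟨rfl, h1⟩, mergePlane_of_ne _ _ (by simp)⟩
      · refine ⟨1, 0, y - s, Or.inl ⟨rfl, rfl, by omega, by omega⟩, ?_⟩
        rw [mergePlane_of_eq]
        simp [h1.1]
  have htr : ∀ s, (planeHost T).Transports (planeHost T) (mergePlane 0 (2 * T + 2) s)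
      (R ++ g) := by
    intro s
    refine transports_mergePlane ?_
    intro u hu v hv hui hvi
    simp only [List.mem_append, memg, memR] at hu hv
    omega
  have hHnodup : ∀ s, (H s).Nodup := by
    intro s
    refine List.Nodup.map_on ?_ (List.nodup_append'.2 ⟨nodup_block ..,
      hg.nodup_iff.2 (nodup_block ..), ?_⟩)
    · intro x hx y hy e
      exact (htr s).injOn (Host.mem_region _ hx) (Host.mem_region _ hy) e
    · intro q hq hq'
      rw [memR] at hq
      rw [memg] at hq'
      omega
  have hHlen : ∀ s, (H s).length = N + 1 + w := by
    intro s
    simp [H, hR, length_block, hg.length_eq]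
  have colC : ∀ s, ∀ j < w, (planeHost T).color A (H s) (0, 0, (j : ℤ)) = C j := by
    intro s j hj
    have hm : ((0, 0, (j : ℤ)) : Pt) ∈ g := (memg _).2 ⟨rfl, rfl, by simp, by simpa using hj⟩
    have e := (htr s).color_eq A (List.mem_append_right R hm)
    rw [mergePlane_of_ne _ _ (by simp)] at e
    rw [hC, rowColor]
    refine e.trans (Host.color_append_of_notMem _ _ ?_)
    rw [memR]
    simp
  have colD : ∀ s, ∀ j ≤ N,
      (planeHost T).color A (H s) (0, 2 * T + 2, s + (j : ℕ)) = D j := by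
    intro s j hj
    have hm : ((1, 0, (j : ℤ)) : Pt) ∈ R := (memR _).2 ⟨rfl, rfl, by simp, by simpa using hj⟩
    have e := (htr s).color_eq A (List.mem_append_left g hm)
    rw [show (1 : ℕ) = 0 + 1 from rfl, mergePlane_of_eq, zero_add, add_comm _ s] at e
    exact e
  have hwM' : ((w + (2 * T + 2) : ℕ) : ℤ) ≤ M := by
    have : w + (2 * T + 2) ≤ M := by nlinarith
    exact_mod_cast this
  by_cases hgood : (planeHost T).Proper A (H 0) → ∀ x len, x + len ≤ N → M ≤ len →
      (len : ℤ) ≤ (M : ℤ) * |segPotential D x len|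
  · refine ⟨H 0, 0, 0, hHnodup 0, by rw [hHlen]; omega, ?_, ?_, ?_⟩
    · intro q hq
      rw [memH] at hq
      push_cast at hwM' ⊢
      omega
    · intro j hj
      rw [memH]
      simp only [true_and]
      omega
    · intro hp x len hx hlen
      rw [segPotential_congr (g := D) (b := x) fun j hj => colD 0 _ (by omega)]
      exact hgood hp x len hx hlen
  rw [Classical.not_imp] at hgood
  obtain ⟨hp, hbad⟩ := hgood
  have properC : ∀ j, j + 1 < w → C j ≠ C (j + 1) := by
    intro j hj
    rw [← colC 0 j (by omega), ← colC 0 (j + 1) hj]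
    refine hp _ ?_ _ ?_ (Or.inl ⟨rfl, rfl, by push_cast; ring⟩)
    · rw [memH]; simp only [true_and]; omega
    · rw [memH]; simp only [true_and]; push_cast; omega
  obtain ⟨σ, a, n, hσ, han, hk, hpre⟩ :=
    exists_minimal_segment C w (4 * T + 1) ⟨a₀, n₀, han₀, hseg properC⟩
  have hn : 1 ≤ n := by
    rcases Nat.eq_zero_or_pos n with rfl | hn
    · simp [segPotential] at hk
      omega
    · exact hn
  -- otherwise every window of the row would follow the segment up to an error of `4T`
  obtain ⟨x, r, hxr, hrn, hwin⟩ : ∃ x r, x + r ≤ N ∧ r ≤ n ∧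
      σ * segPotential D x r < σ * segPotential C a r - 4 * T := by
    by_contra! hc
    refine hbad fun x len => le_abs_segPotential D σ hσ n N T M hT hn ?_ ?_ ?_ x len
    · refine le_trans (Nat.mul_le_mul_left _ ?_) hb2
      omega
    · intro x hx
      have := hc x n hx le_rfl
      push_cast at hk
      linarith
    · intro x r hr hx
      have h1 := hc x r hx hr.le
      have h2 := hpre r hr
      linarith
  -- this translation puts column `x` of the row below column `a` of the segment
  set s : ℤ := a - x with hs
  set B := block 0 1 a (2 * T + 1) (r + 1) with hB
  have memB : ∀ q, q ∈ B ↔ q.1 = 0 ∧ 1 ≤ q.2.1 ∧ q.2.1 ≤ 2 * T + 1 ∧ (a : ℤ) ≤ q.2.2 ∧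
      q.2.2 ≤ a + r := by
    intro q
    rw [hB, mem_block]
    push_cast
    omega
  refine ⟨B ++ H s, min 0 s, s, ?_, ?_, ?_, ?_, ?_⟩
  · refine List.nodup_append'.2 ⟨nodup_block .., hHnodup s, ?_⟩
    intro q hq hq'
    rw [memB] at hq
    rw [memH] at hq'
    omega
  · rw [List.length_append, hHlen, hB, length_block]
    have : (2 * T + 1) * (r + 1) ≤ (2 * T + 1) * w := Nat.mul_le_mul_left _ (by omega)
    nlinarith
  · intro q hq
    rw [List.mem_append, memB, memH] at hq
    push_cast at hwM' ⊢
    omega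
  · intro j hj
    rw [List.mem_append, memH]
    right
    simp only [true_and]
    omega
  · intro hp'
    exfalso
    let c : ℕ → ℕ → Color := fun i j => (planeHost T).color A (B ++ H s) (0, (i : ℤ), (j : ℤ))
    have hmem : ∀ i ≤ 2 * T + 2, ∀ j ≤ r, ((0, (i : ℤ), ((a + j : ℕ) : ℤ)) : Pt) ∈ B ++ H s := by
      intro i hi j hj
      rw [List.mem_append, memB, memH]
      simp only [true_and]
      push_cast
      omega
    have hrect := abs_segPotential_sub_le c a r T hT
      (fun i hi j hj => hp' _ (hmem i hi j hj.le) _ (hmem i hi (j + 1) hj)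
        (Or.inl ⟨rfl, rfl, by push_cast; ring⟩))
      (fun i hi j hj => hp' _ (hmem i hi.le j hj) _ (hmem (i + 1) hi j hj)
        (Or.inr ⟨rfl, by push_cast; ring, rfl⟩))
    have e0 : segPotential (c 0) a r = segPotential C a r := by
      refine segPotential_congr fun j hj => ?_
      rw [← colC s _ (by omega : a + j < w)]
      refine Host.color_append_of_notMem _ _ ?_
      rw [memB]
      simp
    have e1 : segPotential (c (2 * T + 2)) a r = segPotential D x r := by
      refine segPotential_congr fun j hj => ?_
      rw [← colD s _ (by omega : x + j ≤ N)]
      have e2 : ((0, ((2 * T + 2 : ℕ) : ℤ), ((a + j : ℕ) : ℤ)) : Pt) =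
          (0, 2 * (T : ℤ) + 2, s + ((x + j : ℕ) : ℤ)) := by
        simp only [Prod.mk.injEq, true_and]
        push_cast
        omega
      simp only [c]
      rw [e2]
      refine Host.color_append_of_notMem _ _ ?_
      rw [memB]
      simp
    rw [e0, e1] at hrect
    have h1 : σ * segPotential C a r - σ * segPotential D x r ≤
        |segPotential C a r - segPotential D x r| := by
      calc _ = σ * (segPotential C a r - segPotential D x r) := by ring
        _ ≤ |σ * (segPotential C a r - segPotential D x r)| := le_abs_self _
        _ = _ := by rw [abs_mul, hσ, one_mul]
    linarith

/-! ### Realization in the grid -/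

theorem gridGraph_adj_iff {m : ℕ} {u v : Node m} : (gridGraph m).Adj u v ↔
    ((u.1.val : ℤ) - v.1.val).natAbs + ((u.2.val : ℤ) - v.2.val).natAbs = 1 := by
  simp only [gridGraph, SimpleGraph.fromRel_adj, IsEast, IsSouth, ne_eq, Prod.ext_iff, Fin.ext_iff]
  omega

/-- The distance in the grid is the Manhattan distance. -/
theorem gridGraph_dist {m : ℕ} (u v : Node m) : (gridGraph m).dist u v =
    ((u.1.val : ℤ) - v.1.val).natAbs + ((u.2.val : ℤ) - v.2.val).natAbs := by
  have exists_walk : ∀ (n : ℕ) (u : Node m),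
      ((u.1.val : ℤ) - v.1.val).natAbs + ((u.2.val : ℤ) - v.2.val).natAbs = n →
      ∃ p : (gridGraph m).Walk u v, p.length = n := by
    intro n
    induction n with
    | zero =>
      intro u hu
      obtain rfl : u = v := by
        simp only [Prod.ext_iff, Fin.ext_iff]
        omega
      exact ⟨.nil, rfl⟩
    | succ n ih =>
      intro u hu
      obtain ⟨w, hw, hn⟩ : ∃ w, (gridGraph m).Adj u w ∧
          ((w.1.val : ℤ) - v.1.val).natAbs + ((w.2.val : ℤ) - v.2.val).natAbs = n := by
        obtain ⟨⟨a, ha⟩, ⟨b, hb⟩⟩ := u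
        obtain ⟨⟨a', ha'⟩, ⟨b', hb'⟩⟩ := v
        simp only [gridGraph_adj_iff] at hu ⊢
        rcases lt_trichotomy a a' with h | h | h
        · exact ⟨(⟨a + 1, by omega⟩, ⟨b, hb⟩), by simp only; omega, by simp only; omega⟩
        · rcases lt_trichotomy b b' with h' | h' | h'
          · exact ⟨(⟨a, ha⟩, ⟨b + 1, by omega⟩), by simp only; omega, by simp only; omega⟩
          · omega
          · exact ⟨(⟨a, ha⟩, ⟨b - 1, by omega⟩), by simp only; omega, by simp only; omega⟩
        · exact ⟨(⟨a - 1, by omega⟩, ⟨b, hb⟩), by simp only; omega, by simp only; omega⟩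
      obtain ⟨p, hp⟩ := ih w hn
      exact ⟨.cons hw p, by simp [hp]⟩
  have le_length : ∀ (u w : Node m) (p : (gridGraph m).Walk u w),
      ((u.1.val : ℤ) - w.1.val).natAbs + ((u.2.val : ℤ) - w.2.val).natAbs ≤ p.length := by
    intro u w p
    induction p with
    | nil => simp
    | cons h p ih =>
      rw [gridGraph_adj_iff] at h
      rw [SimpleGraph.Walk.length_cons]
      omega
  obtain ⟨p, hp⟩ := exists_walk _ u rfl
  refine le_antisymm (hp ▸ SimpleGraph.dist_le p) ?_
  obtain ⟨q, hq⟩ := p.reachable.exists_walk_length_eq_dist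
  exact hq ▸ le_length _ _ q

/-- The oriented grid, seen with locality `T`. -/
def gridHost (m T : ℕ) : Host (Node m) where
  east := IsEast
  south := IsSouth
  near v x := (gridGraph m).dist v x ≤ T
  near_self v := by simp

theorem gridHost_run {m : ℕ} (A : OnlineAlgorithm) (T : ℕ) (h : List (Node m)) :
    (gridHost m T).run A h = A.run T h := by
  induction h with
  | nil => rfl
  | cons v h ih =>
    rw [Host.run, OnlineAlgorithm.run, ih]
    rfl

theorem gridHost_color {m : ℕ} (A : OnlineAlgorithm) (T : ℕ) (h : List (Node m)) (u : Node m) :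
    (gridHost m T).color A h u = A.color T h u := by
  induction h with
  | nil => rfl
  | cons v h ih =>
    rw [Host.color, OnlineAlgorithm.color, ih, gridHost_run]
    rfl

/-- The coordinates in plane `0` of a node of the grid, when the node in row `T` and column `T`
gets the coordinates `(0, lo)`. -/
def gridCoord {m : ℕ} (T : ℕ) (lo : ℤ) (v : Node m) : Pt :=
  (0, (v.1.val : ℤ) - T, (v.2.val : ℤ) - T + lo)

/-- A history that stays at distance `T` from the boundary of the grid looks as it does in the
plane. -/
theorem transports_gridCoord {m T : ℕ} {lo : ℤ} {g : List (Node m)}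
    (hg : ∀ v ∈ g, T ≤ v.1.val ∧ v.1.val + T < m ∧ T ≤ v.2.val ∧ v.2.val + T < m) :
    (gridHost m T).Transports (planeHost T) (gridCoord T lo) g := by
  refine ⟨?_, ?_, ?_, ?_⟩
  · intro u _ v _ huv
    simp only [gridCoord, Prod.mk.injEq] at huv
    simp only [Prod.ext_iff, Fin.ext_iff]
    omega
  · intro u _ v _
    simp only [gridHost, planeHost, gridCoord, IsEast, Fin.ext_iff, true_and]
    omega
  · intro u _ v _
    simp only [gridHost, planeHost, gridCoord, IsSouth, Fin.ext_iff, true_and]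
    omega
  · rintro v hv ⟨p, x, y⟩
    have := hg v hv
    simp only [gridHost, planeHost, gridCoord, gridGraph_dist, Prod.mk.injEq]
    constructor
    · rintro ⟨rfl, h⟩
      refine ⟨(⟨(x + T).toNat, by omega⟩, ⟨(y + T - lo).toNat, by omega⟩), ?_, rfl, ?_, ?_⟩ <;>
        simp only <;> omega
    · rintro ⟨w, h1, rfl, rfl, rfl⟩
      omega

/-! ### Rows as lists -/

theorem potential_map_range' {V : Type} (c : V → Color) (u : ℕ → V) (x n : ℕ) :
    potential c ((List.range' x (n + 1)).map u) = segPotential (fun j => c (u j)) x n := by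
  induction n generalizing x with
  | zero => simp [potential, segPotential]
  | succ n ih =>
    have h := ih (x + 1)
    rw [List.range'_succ, List.map_cons] at h
    rw [List.range'_succ, List.map_cons, List.range'_succ, List.map_cons, potential, h,
      add_comm n 1, segPotential_add]
    simp [segPotential]

/-- Contiguous pieces of a list indexed by a range are indexed by subintervals. -/
theorem exists_eq_map_range'_of_infix {V : Type} {u : ℕ → V} {n : ℕ} {l : List V}
    (h : l <:+: (List.range n).map u) :
    ∃ x, x + l.length ≤ n ∧ l = (List.range' x l.length).map u := by
  obtain ⟨s, t, hst⟩ := h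
  have hlen := congrArg List.length hst
  simp only [List.length_append, List.length_map, List.length_range] at hlen
  refine ⟨s.length, by omega, List.ext_getElem (by simp) fun j hj _ => ?_⟩
  have h1 : ((List.range n).map u)[s.length + j]? = some l[j] := by
    rw [← hst, List.append_assoc, List.getElem?_append_right (by omega),
      Nat.add_sub_cancel_left, List.getElem?_append_left hj, List.getElem?_eq_getElem hj]
  rw [List.getElem?_eq_getElem (by simp; omega)] at h1
  simpa using (Option.some.inj h1).symm

end OnlineLocalGrid

open OnlineLocalGrid in
theorem mainTheorem2 :
    ∃ K : ℕ, ∀ T : ℕ → ℕ, (∀ n, 1 ≤ T n) →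
      (fun n : ℕ => (T n : ℝ)) =o[Filter.atTop] (fun n : ℕ => Real.log (n : ℝ)) →
      ∀ᶠ m : ℕ in Filter.atTop, ∀ (A : OnlineAlgorithm) (N : ℕ),
        N + 2 ^ (10 * T (m ^ 2) + 1) ≤ m →
        ∃ h : List (Node m), h.Nodup ∧ h.length ≤ (N + 1) + 2 ^ (10 * T (m ^ 2)) ∧
          (ProperOn (A.color (T (m ^ 2)) h) h →
            ∃ R : List (Node m), IsRow R ∧ R.length = N + 1 ∧ R ⊆ h ∧
              ∀ W' : List (Node m), W' <:+: R → 2 ^ (10 * T (m ^ 2)) ≤ pathLength W' →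
                (1 / 2 ^ (K * T (m ^ 2)) : ℝ) * (pathLength W' : ℝ) ≤
                  ((|potential (A.color (T (m ^ 2)) h) W'| : ℤ) : ℝ)) := by
  refine ⟨10, fun T' hT' _ => Filter.Eventually.of_forall fun m A N hN => ?_⟩
  have hT : 1 ≤ T' (m ^ 2) := hT' _
  generalize T' (m ^ 2) = T at *
  obtain ⟨h, lo, s, hnd, hlen, hbox, hrow, hpot⟩ := exists_history A T N hT
  have hTM : 10 * T < 2 ^ (10 * T) := Nat.lt_two_pow_self
  rw [pow_succ] at hN
  generalize hM : 2 ^ (10 * T) = M at *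
  obtain ⟨g, rfl⟩ : h ∈ Set.range (List.map (gridCoord (m := m) T lo)) := by
    rw [Set.range_list_map]
    rintro ⟨p, x, y⟩ hq
    obtain ⟨rfl, h1, h2, h3, h4⟩ := hbox _ hq
    push_cast at h1 h2 h3 h4
    refine ⟨(⟨(x + T).toNat, by omega⟩, ⟨(y + T - lo).toNat, ?_⟩), ?_⟩
    · omega
    · simp only [gridCoord, Prod.mk.injEq, true_and]
      omega
  have htr : (gridHost m T).Transports (planeHost T) (gridCoord T lo) g := by
    refine transports_gridCoord fun v hv => ?_
    obtain ⟨-, h1, h2, h3, h4⟩ := hbox _ (List.mem_map_of_mem hv)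
    simp only [gridCoord] at h1 h2 h3 h4
    push_cast at h4
    omega
  have hcol : ∀ v ∈ g, (planeHost T).color A (g.map (gridCoord T lo)) (gridCoord T lo v) =
      A.color T g v := fun v hv => (htr.color_eq A hv).trans (gridHost_color A T g v)
  refine ⟨g, List.Nodup.of_map _ hnd, by simpa using hlen, fun hprop => ?_⟩
  have hpot := hpot (by
    intro q hq q' hq' hadj
    obtain ⟨v, hv, rfl⟩ := List.mem_map.1 hq
    obtain ⟨v', hv', rfl⟩ := List.mem_map.1 hq'
    rw [hcol v hv, hcol v' hv']
    refine hprop v hv v' hv' (gridGraph_adj_iff.2 ?_)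
    simp only [planeHost, gridCoord] at hadj
    omega)
  have hex : ∀ j, ∃ v : Node m, j ≤ N →
      v ∈ g ∧ gridCoord T lo v = (0, 2 * (T : ℤ) + 2, s + (j : ℕ)) := by
    intro j
    by_cases hj : j ≤ N
    · obtain ⟨v, hv⟩ := List.mem_map.1 (hrow j hj)
      exact ⟨v, fun _ => hv⟩
    · obtain ⟨v, -⟩ := List.mem_map.1 (hrow 0 (Nat.zero_le _))
      exact ⟨v, fun hc => absurd hc hj⟩
  choose u hu using hex
  refine ⟨(List.range (N + 1)).map u, ?_, by simp, ?_, ?_⟩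
  · rw [IsRow, List.isChain_iff_getElem]
    intro j hj
    simp only [List.length_map, List.length_range] at hj
    have h1 := (hu j (by omega)).2
    have h2 := (hu (j + 1) (by omega)).2
    simp only [gridCoord, Prod.mk.injEq] at h1 h2
    simp only [List.getElem_map, List.getElem_range, IsEast, Fin.ext_iff]
    push_cast at h2
    omega
  · intro v hv
    obtain ⟨j, hj, rfl⟩ := List.mem_map.1 hv
    exact (hu j (by simpa [Nat.lt_succ_iff] using hj)).1
  · intro W hW hlenW
    obtain ⟨x, hx, hWeq⟩ := exists_eq_map_range'_of_infix hW
    obtain ⟨n, hn⟩ : ∃ n, W.length = n + 1 := Nat.exists_eq_succ_of_ne_zero (by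
      intro h0
      rw [pathLength, h0] at hlenW
      omega)
    have hpl : pathLength W = n := by rw [pathLength, hn]; rfl
    rw [hpl] at hlenW ⊢
    rw [hn] at hWeq hx
    have h1 := hpot x n (by omega) hlenW
    have h2 : segPotential (fun j => (planeHost T).color A (g.map (gridCoord T lo))
        (0, 2 * T + 2, s + (j : ℕ))) x n = potential (A.color T g) W := by
      rw [hWeq, potential_map_range']
      refine segPotential_congr fun j hj => ?_
      have h3 := hu (x + j) (by omega)
      rw [← h3.2, hcol _ h3.1]
    rw [h2] at h1
    rw [one_div, inv_mul_le_iff₀ (by positivity)]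
    subst hM
    exact_mod_cast h1
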